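/- Formulas are built from atomic propositions $p$ and $\bot$ by $\to$ and $\Box$. A sequent $\Gamma\Rightarrow\Delta$ is a pair of finite multisets of formulas. The calculus $\mathsf{Grz}_\infty$ has the initial sequents $\Gamma,p\Rightarrow p,\Delta$ ($p$ atomic) and $\Gamma,\bot\Rightarrow\Delta$, and the rules $$\frac{\Gamma,B\Rightarrow\Delta\qquad \Gamma\Rightarrow A,\Delta}{\Gamma,A\to B\Rightarrow\Delta}\,(\to_L),\qquad \frac{\Gamma,A\Rightarrow B,\Delta}{\Gamma\Rightarrow A\to B,\Delta}\,(\to_R),$$ $$\frac{\Gamma,B,\Box B\Rightarrow\Delta}{\Gamma,\Box B\Rightarrow\Delta}\,(\mathsf{refl}),\qquad \frac{\Gamma,\Box\Pi\Rightarrow A,\Delta\qquad \Box\Pi\Rightarrow A}{\Gamma,\Box\Pi\Rightarrow\Box A,\Delta}\,(\Box).$$ An $\infty$-proof is a possibly infinite tree of sequents constructed according to these rules whose leaves are marked by initial sequents and in which every infinite branch passes through a right premise of the rule $(\Box)$ infinitely many times. A sequent is provable in $\mathsf{Grz}_\infty$ if it marks the root of some $\infty$-proof. A cyclic proof of $\Gamma\Rightarrow\Delta$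 is a pair $(\kappa,d)$, where $\kappa$ is a finite tree of sequents constructed according to the rules of $\mathsf{Grz}_\infty$ with root marked by $\Gamma\Rightarrow\Delta$ (its leaves may be marked by arbitrary sequents), and $d$ is a function defined on the set of all leaves of $\kappa$ that are not marked by initial sequents, such that for every such leaf $a$: the node $d(a)$ lies on the path from the root to $a$; $a$ and $d(a)$ are marked by the same sequent; and some node on the path from $d(a)$ to $a$, different from $d(a)$ (possibly $a$ itself), is a right premise of the rule $(\Box)$. The unravelling of $(\kappa,d)$ is the possibly infinite tree of sequents obtained by following $\kappa$ from the root and, whenever a leaf $a$ in the domain of $d$ is reached, continuing from $d(a)$ instead. **Theorem.** If $\mathsf{Grz}_\infty\vdash\Gamma\Rightarrow\Delta$, then there is a cyclic proof of $\Gamma\Rightarrow\Delta$, and its unravelling is an $\infty$-proof (of the same sequent). -/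

import Mathlib

namespace GrzInf

universe u

/-- Modal formulas over a set `α` of atomic propositions. -/
inductive Formula (α : Type u) : Type u
  | bot : Formula α
  | atom : α → Formula α
  | imp : Formula α → Formula α → Formula α
  | box : Formula α → Formula α

/-- A sequent `Γ ⇒ Δ`: a pair of finite multisets of formulas. -/
@[ext]
structure Sequent (α : Type u) : Type u where
  ante : Multiset (Formula α)
  succ : Multiset (Formula α)

/-- Initial sequents `Γ, p ⇒ p, Δ` (with `p` atomic) and `Γ, ⊥ ⇒ Δ`. -/
inductive Initial {α : Type u} : Sequent α → Prop
  | ax (p : α) (Γ Δ : Multiset (Formula α)) :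
      Initial ⟨Formula.atom p ::ₘ Γ, Formula.atom p ::ₘ Δ⟩
  | bot (Γ Δ : Multiset (Formula α)) : Initial ⟨Formula.bot ::ₘ Γ, Δ⟩

/-- Names of the inference rules. -/
inductive Rule : Type
  | impL
  | impR
  | refl
  | box

/-- `Inference r l s`: the sequent `s` follows from the list of premises `l` (from left to right)
by one application of the rule `r`. -/
inductive Inference {α : Type u} : Rule → List (Sequent α) → Sequent α → Prop
  | impL (Γ Δ : Multiset (Formula α)) (A B : Formula α) :
      Inference Rule.impL [⟨B ::ₘ Γ, Δ⟩, ⟨Γ, A ::ₘ Δ⟩] ⟨Formula.imp A B ::ₘ Γ, Δ⟩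
  | impR (Γ Δ : Multiset (Formula α)) (A B : Formula α) :
      Inference Rule.impR [⟨A ::ₘ Γ, B ::ₘ Δ⟩] ⟨Γ, Formula.imp A B ::ₘ Δ⟩
  | refl (Γ Δ : Multiset (Formula α)) (B : Formula α) :
      Inference Rule.refl [⟨B ::ₘ Formula.box B ::ₘ Γ, Δ⟩] ⟨Formula.box B ::ₘ Γ, Δ⟩
  | box (Γ Θ Δ : Multiset (Formula α)) (A : Formula α) :
      Inference Rule.box [⟨Γ + Θ.map Formula.box, A ::ₘ Δ⟩, ⟨Θ.map Formula.box, {A}⟩]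
        ⟨Γ + Θ.map Formula.box, Formula.box A ::ₘ Δ⟩

/-- A possibly infinite ordered tree of sequents. A node is the list of directions leading to it
from the root, so the root is `[]` and the `i`-th child of `v` is `v ++ [i]` (with `i = 0` the
leftmost). `label v` is the sequent that marks `v`, and `none` if `v` is not a node. -/
@[ext]
structure SeqTree (α : Type u) : Type u where
  label : List ℕ → Option (Sequent α)
  root_mem : label [] ≠ none
  closed : ∀ (v : List ℕ) (i : ℕ), label v = none → label (v ++ [i]) = none

namespace SeqTree

variable {α : Type u}

/-- `v` is a leaf of the tree. -/
def IsLeaf (T : SeqTree α) (v : List ℕ) : Prop :=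
  T.label v ≠ none ∧ ∀ i : ℕ, T.label (v ++ [i]) = none

/-- `v` is a leaf that is marked by an initial sequent. -/
def IsInitialLeaf (T : SeqTree α) (v : List ℕ) : Prop :=
  T.IsLeaf v ∧ ∃ s, T.label v = some s ∧ Initial s

/-- `v` is a leaf that is not marked by an initial sequent. -/
def IsOpenLeaf (T : SeqTree α) (v : List ℕ) : Prop :=
  T.IsLeaf v ∧ ¬ ∃ s, T.label v = some s ∧ Initial s

/-- The sequent at the node `v` is obtained from the sequents at its children (all of them, in
order) by an application of the rule `r`. -/
def IsStep (T : SeqTree α) (r : Rule) (v : List ℕ) : Prop :=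
  ∃ (s : Sequent α) (l : List (Sequent α)),
    T.label v = some s ∧ Inference r l s ∧ ∀ i : ℕ, T.label (v ++ [i]) = l[i]?

/-- `v` is the right premise of an application of the modal rule. -/
def IsRightPremise (T : SeqTree α) (v : List ℕ) : Prop :=
  ∃ w : List ℕ, v = w ++ [1] ∧ T.IsStep Rule.box w

/-- The node of depth `n` on the branch that takes the directions `f 0, f 1, f 2, …`. -/
def branchNode (f : ℕ → ℕ) (n : ℕ) : List ℕ := (List.range n).map f

/-- `T` is an `∞`-proof: its leaves are marked by initial sequents, all other nodes are obtained
by the inference rules, and every infinite branch passes through right premises of the modal rule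
infinitely many times. -/
structure IsInfProof (T : SeqTree α) : Prop where
  local_correct : ∀ v : List ℕ, T.label v ≠ none → T.IsInitialLeaf v ∨ ∃ r, T.IsStep r v
  branch : ∀ f : ℕ → ℕ, (∀ n, T.label (branchNode f n) ≠ none) →
    ∀ N : ℕ, ∃ n, N ≤ n ∧ T.IsRightPremise (branchNode f n)

end SeqTree

/-- Provability of a sequent by an `∞`-proof. -/
def Provable {α : Type u} (s : Sequent α) : Prop :=
  ∃ T : SeqTree α, T.IsInfProof ∧ T.label [] = some s

/-- A cyclic proof: a finite tree `κ` of sequents constructed by the inference rules, with a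
back-link function `d` on the leaves of `κ` that are not marked by initial sequents. The node
`d a` lies on the path from the root to `a` and is marked by the same sequent as `a`, and there is
a right premise of the modal rule on this path strictly after `d a` and up to `a` (inclusive). -/
structure CyclicProof (α : Type u) : Type u where
  κ : SeqTree α
  finite : {v : List ℕ | κ.label v ≠ none}.Finite
  local_correct : ∀ v : List ℕ, κ.label v ≠ none → κ.IsLeaf v ∨ ∃ r, κ.IsStep r v
  d : {a : List ℕ // κ.IsOpenLeaf a} → List ℕ
  d_prefix : ∀ a, d a <+: a.1
  d_label : ∀ a, κ.label (d a) = κ.label a.1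
  d_progress : ∀ a, ∃ v : List ℕ, d a <+: v ∧ v ≠ d a ∧ v <+: a.1 ∧ κ.IsRightPremise v

namespace CyclicProof

variable {α : Type u}

open Classical in
/-- Follow the back-link if there is one at `v`. -/
noncomputable def jump (c : CyclicProof α) (v : List ℕ) : List ℕ :=
  if h : c.κ.IsOpenLeaf v then c.d ⟨v, h⟩ else v

/-- The node of `κ` that is reached from the root by the directions `w`, where a back-link is
followed as soon as its leaf is reached. -/
noncomputable def pos (c : CyclicProof α) (w : List ℕ) : List ℕ :=
  w.foldl (fun v i => c.jump (v ++ [i])) []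

/-- The unravelling of a cyclic proof: the tree of all paths from the root along the edges and the
back-links. -/
noncomputable def unravel (c : CyclicProof α) : SeqTree α where
  label w := c.κ.label (c.pos w)
  root_mem := c.κ.root_mem
  closed w i h := by
    have h1 : c.κ.label (c.pos w ++ [i]) = none := c.κ.closed _ i h
    have h2 : ¬ c.κ.IsOpenLeaf (c.pos w ++ [i]) := fun h' => h'.1.1 h1
    have h3 : c.pos (w ++ [i]) = c.jump (c.pos w ++ [i]) := by simp [pos]
    rw [h3, jump, dif_neg h2, h1]

end CyclicProof

end GrzInf

/-! An infinite branch cannot avoid right premises of (□) forever, so between consecutive right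
premises an ∞-proof is well-founded (`IsInfProof.wellFounded_localChild`). Right premises have the
form □Π ⇒ A over subformulas of the root sequent. If Π were always a set, only finitely many could
occur, and repetitions could be closed by back-links. Multiplicities in Π are unbounded, however, so
contraction has to be built in.

This happens in `cyc_of_covers`, which rebuilds the proof for every sequent `s` that covers a
sequent `t` of it: each occurrence in `t` is present in `s` or is replaced by what inverting rules
on it leaves in `s`. A rule of the ∞-proof is skipped when `s` already covers a suitable premise,
and is otherwise copied, with Π reduced to a set in (□). The outer induction counts the set-shaped
right premises not yet used; the inner one is along the well-founded relation.

Every open leaf of the resulting tree is itself a right premise, so any link to an earlier equal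
sequent makes progress. Conversely, if a branch of an unravelling met only finitely many right
premises, it would eventually follow no back-link, and so climb forever in a finite tree
(`unravel_isInfProof`). -/

namespace GrzInf

variable {α : Type*}

/-! ### Infinite branches, and grafting of trees -/

namespace SeqTree

lemma label_ne_none_of_append (T : SeqTree α) (v w : List ℕ) (h : T.label (v ++ w) ≠ none) :
    T.label v ≠ none := by
  induction w using List.reverseRecOn with
  | nil => simpa using h
  | append_singleton w i ih =>
    refine ih fun h' => h ?_
    rw [← List.append_assoc]
    exact T.closed _ i h'

lemma label_ne_none_of_prefix (T : SeqTree α) {v w : List ℕ} (hvw : v <+: w)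
    (h : T.label w ≠ none) : T.label v ≠ none := by
  obtain ⟨u, rfl⟩ := hvw
  exact T.label_ne_none_of_append v u h

lemma branchNode_succ (f : ℕ → ℕ) (n : ℕ) :
    branchNode f (n + 1) = branchNode f n ++ [f n] := by
  simp [branchNode, List.range_succ]

/-- `w` is a child of `v` which is not a right premise of the modal rule. -/
def LocalChild (T : SeqTree α) (w v : List ℕ) : Prop :=
  (∃ i, w = v ++ [i]) ∧ T.label w ≠ none ∧ ¬ T.IsRightPremise w

lemma IsInfProof.wellFounded_localChild {T : SeqTree α} (hT : T.IsInfProof) :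
    WellFounded T.LocalChild := by
  rw [wellFounded_iff_isEmpty_descending_chain]
  refine ⟨fun ⟨g, hg⟩ => ?_⟩
  have hlen : ∀ n, (g n).length = (g 0).length + n := by
    intro n
    induction n with
    | zero => rfl
    | succ n ih =>
      obtain ⟨i, hi⟩ := (hg n).1
      rw [hi, List.length_append, ih]
      simp [Nat.add_assoc]
  have hpre : ∀ n k, g n <+: g (n + k) := by
    intro n k
    induction k with
    | zero => exact List.prefix_rfl
    | succ k ih =>
      obtain ⟨i, hi⟩ := (hg (n + k)).1
      exact ih.trans ⟨[i], by rw [← Nat.add_assoc, hi]⟩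
  obtain ⟨f, hf⟩ : ∃ f : ℕ → ℕ, ∀ n, branchNode f n = (g n).take n := by
    -- The chain may start anywhere, so the directions are read off its nodes. Since `g (k + 1)` has
    -- length greater than `k`, the default `0` is never used.
    refine ⟨fun k => (g (k + 1))[k]?.getD 0, fun n => ?_⟩
    induction n with
    | zero => simp [branchNode]
    | succ n ih =>
      have hn : n < (g (n + 1)).length := by rw [hlen]; omega
      have h1 : (g (n + 1)).take n = (g n).take n := by
        obtain ⟨i, hi⟩ := (hg n).1
        rw [hi, List.take_append_of_le_length (by rw [hlen]; omega)]
      rw [branchNode_succ, ih, List.take_add_one, h1]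
      simp [hn]
  have hmem : ∀ n, T.label (g (n + 1)) ≠ none := fun n => (hg n).2.1
  have hbranch : ∀ n, T.label (branchNode f n) ≠ none := by
    intro n
    rw [hf]
    exact T.label_ne_none_of_prefix ((List.take_prefix _ _).trans (hpre n 1)) (hmem n)
  -- The `+ 1` skips `g 0`, which may itself be a right premise.
  obtain ⟨n, hn, hR⟩ := hT.branch f hbranch ((g 0).length + 1)
  obtain ⟨k, rfl⟩ : ∃ k, n = (g 0).length + (k + 1) := ⟨n - (g 0).length - 1, by omega⟩
  have h2 : branchNode f ((g 0).length + (k + 1)) = g (k + 1) := by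
    rw [hf]
    have hk := List.prefix_iff_eq_take.1 (hpre (k + 1) (g 0).length)
    rw [hlen, Nat.add_comm (k + 1)] at hk
    exact hk.symm
  rw [h2] at hR
  exact (hg k).2.2 hR

/-- The tree with root marked by `s` and immediate subtrees `ts`. -/
def node (s : Sequent α) (ts : List (SeqTree α)) : SeqTree α where
  label
    | [] => some s
    | i :: v => ts[i]?.bind fun T => T.label v
  root_mem := by simp
  closed v i h := by
    cases v with
    | nil => simp at h
    | cons j v =>
      simp only [List.cons_append]
      rcases ht : ts[j]? with _ | T
      · rfl
      · simp only [ht, Option.bind_some] at h ⊢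
        exact T.closed v i h

lemma node_label_cons {s : Sequent α} {ts : List (SeqTree α)} {i : ℕ} {T : SeqTree α}
    (h : ts[i]? = some T) (v : List ℕ) : (node s ts).label (i :: v) = T.label v := by
  simp [node, h]

lemma node_label_cons_none {s : Sequent α} {ts : List (SeqTree α)} {i : ℕ}
    (h : ts[i]? = none) (v : List ℕ) : (node s ts).label (i :: v) = none := by
  simp [node, h]

lemma node_isStep_cons {s : Sequent α} {ts : List (SeqTree α)} {i : ℕ} {T : SeqTree α}
    (h : ts[i]? = some T) {r : Rule} {v : List ℕ} :
    (node s ts).IsStep r (i :: v) ↔ T.IsStep r v := by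
  simp only [IsStep, List.cons_append, node_label_cons h]

lemma node_isLeaf_cons {s : Sequent α} {ts : List (SeqTree α)} {i : ℕ} {T : SeqTree α}
    (h : ts[i]? = some T) {v : List ℕ} : (node s ts).IsLeaf (i :: v) ↔ T.IsLeaf v := by
  simp only [IsLeaf, List.cons_append, node_label_cons h]

lemma node_isOpenLeaf_cons {s : Sequent α} {ts : List (SeqTree α)} {i : ℕ} {T : SeqTree α}
    (h : ts[i]? = some T) {v : List ℕ} : (node s ts).IsOpenLeaf (i :: v) ↔ T.IsOpenLeaf v := by
  simp only [IsOpenLeaf, node_isLeaf_cons h, node_label_cons h]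

lemma node_isRightPremise_cons {s : Sequent α} {ts : List (SeqTree α)} {i : ℕ} {T : SeqTree α}
    (h : ts[i]? = some T) {v : List ℕ} (hv : T.IsRightPremise v) :
    (node s ts).IsRightPremise (i :: v) := by
  obtain ⟨w, rfl, hw⟩ := hv
  exact ⟨i :: w, rfl, (node_isStep_cons h).2 hw⟩

lemma node_isStep_nil {s : Sequent α} {ts : List (SeqTree α)} {r : Rule} {l : List (Sequent α)}
    (h : Inference r l s) (hl : ts.map (fun T => T.label []) = l.map some) :
    (node s ts).IsStep r [] := by
  refine ⟨s, l, rfl, h, fun i => ?_⟩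
  have hi := congrArg (fun x => x[i]?) hl
  simp only [List.getElem?_map] at hi
  rcases ht : ts[i]? with _ | T
  · rw [ht] at hi
    rw [List.nil_append, node_label_cons_none ht]
    rcases hl : l[i]? with _ | t
    · rfl
    · simp [hl] at hi
  · rw [ht] at hi
    rw [List.nil_append, node_label_cons ht]
    rcases hl : l[i]? with _ | t
    · simp [hl] at hi
    · simpa [hl] using hi

lemma node_finite (s : Sequent α) (ts : List (SeqTree α))
    (h : ∀ T ∈ ts, {v : List ℕ | T.label v ≠ none}.Finite) :
    {v : List ℕ | (node s ts).label v ≠ none}.Finite := by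
  have hsub : {v : List ℕ | (node s ts).label v ≠ none} ⊆
      {[]} ∪ ⋃ i : Fin ts.length, List.cons i.1 '' {v : List ℕ | (ts[i.1]).label v ≠ none} := by
    rintro (_ | ⟨i, v⟩) hv
    · exact Or.inl rfl
    · right
      by_cases hi : i < ts.length
      · refine Set.mem_iUnion.2 ⟨⟨i, hi⟩, v, ?_, rfl⟩
        rwa [Set.mem_ofPred_eq, node_label_cons (List.getElem?_eq_getElem hi)] at hv
      · exact absurd (node_label_cons_none (by simpa using hi) v) hv
  exact ((Set.finite_singleton _).union (Set.finite_iUnion fun i =>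
    (h _ (List.getElem_mem i.2)).image _)).subset hsub

end SeqTree

/-! ### Unravelling -/

namespace CyclicProof

open SeqTree

lemma d_ne (c : CyclicProof α) (a : {a : List ℕ // c.κ.IsOpenLeaf a}) : c.d a ≠ a.1 := by
  intro h
  obtain ⟨v, h1, h2, h3, -⟩ := c.d_progress a
  rw [h] at h1 h2
  exact h2 (h3.eq_of_length_le h1.length_le)

/-- The target of a back-link is a proper prefix of its leaf and therefore has a child, so one jump
always suffices. -/
lemma jump_not_isOpenLeaf (c : CyclicProof α) (v : List ℕ) : ¬ c.κ.IsOpenLeaf (c.jump v) := by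
  rw [jump]
  split_ifs with h
  · intro h'
    obtain ⟨u, hu⟩ := c.d_prefix ⟨v, h⟩
    rcases u with _ | ⟨i, u⟩
    · exact c.d_ne ⟨v, h⟩ (by simpa using hu)
    · have h1 : c.κ.label ((c.d ⟨v, h⟩ ++ [i]) ++ u) ≠ none := by
        rw [List.append_assoc, List.singleton_append, hu]
        exact h.1.1
      exact c.κ.label_ne_none_of_append _ _ h1 (h'.1.2 i)
  · exact h

lemma jump_prefix (c : CyclicProof α) (v : List ℕ) : c.jump v <+: v := by
  rw [jump]
  split_ifs with h
  · exact c.d_prefix ⟨v, h⟩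
  · exact List.prefix_rfl

lemma label_jump (c : CyclicProof α) (v : List ℕ) : c.κ.label (c.jump v) = c.κ.label v := by
  rw [jump]
  split_ifs with h
  · exact c.d_label ⟨v, h⟩
  · rfl

lemma pos_concat (c : CyclicProof α) (w : List ℕ) (i : ℕ) :
    c.pos (w ++ [i]) = c.jump (c.pos w ++ [i]) := by
  simp [pos]

lemma pos_not_isOpenLeaf (c : CyclicProof α) (w : List ℕ) : ¬ c.κ.IsOpenLeaf (c.pos w) := by
  induction w using List.reverseRecOn with
  | nil =>
    intro h
    exact c.d_ne ⟨_, h⟩ (List.prefix_nil.1 (c.d_prefix ⟨_, h⟩))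
  | append_singleton w i _ =>
    rw [pos_concat]
    exact c.jump_not_isOpenLeaf _

lemma unravel_label (c : CyclicProof α) (w : List ℕ) :
    c.unravel.label w = c.κ.label (c.pos w) := rfl

lemma unravel_label_concat (c : CyclicProof α) (w : List ℕ) (i : ℕ) :
    c.unravel.label (w ++ [i]) = c.κ.label (c.pos w ++ [i]) := by
  rw [unravel_label, pos_concat, label_jump]

lemma unravel_isStep (c : CyclicProof α) (r : Rule) (w : List ℕ) :
    c.unravel.IsStep r w ↔ c.κ.IsStep r (c.pos w) := by
  simp only [IsStep, unravel_label_concat]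
  rfl

/-- The unravelling of a cyclic proof is an `∞`-proof. -/
theorem unravel_isInfProof (c : CyclicProof α) : c.unravel.IsInfProof where
  local_correct w hw := by
    rcases c.local_correct (c.pos w) hw with h | ⟨r, h⟩
    · left
      have h1 := c.pos_not_isOpenLeaf w
      have h2 : ∃ s, c.κ.label (c.pos w) = some s ∧ Initial s := by
        by_contra h3
        exact h1 ⟨h, h3⟩
      exact ⟨⟨hw, fun i => by rw [unravel_label_concat]; exact h.2 i⟩, h2⟩
    · exact Or.inr ⟨r, (c.unravel_isStep r w).2 h⟩
  branch f hf N := by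
    by_contra! hN
    set p : ℕ → List ℕ := fun n => c.pos (branchNode f n) with hp
    have hps : ∀ n, p (n + 1) = c.jump (p n ++ [f n]) := fun n => by
      simp only [hp, branchNode_succ, pos_concat]
    -- Being a right premise depends only on the last direction and the rule at the parent, so it is
    -- not affected by a jump made on arrival.
    have hR : ∀ n, N ≤ n → ¬ c.κ.IsRightPremise (p n ++ [f n]) := by
      rintro n hn ⟨w, hw, hs⟩
      obtain ⟨rfl, h1⟩ := List.append_inj' hw rfl
      refine hN (n + 1) (by omega) ⟨branchNode f n, ?_, (c.unravel_isStep _ _).2 hs⟩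
      rw [branchNode_succ, h1]
    -- A jump only passes to a prefix, so all later positions extend a shortest late one.
    obtain ⟨m, hm, hmin⟩ : ∃ m, N ≤ m ∧ ∀ n, N ≤ n → (p m).length ≤ (p n).length := by
      obtain ⟨m, hm, hmin⟩ := exists_minimalFor_of_wellFoundedLT (N ≤ ·)
        (fun n => (p n).length) ⟨N, le_rfl⟩
      refine ⟨m, hm, fun n hn => ?_⟩
      rcases le_total (p m).length (p n).length with h | h
      · exact h
      · exact hmin hn h
    have key : ∀ k, p m <+: p (m + k) ∧
        ∀ v, p m <+: v → v ≠ p m → v <+: p (m + k) → ¬ c.κ.IsRightPremise v := by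
      intro k
      induction k with
      | zero =>
        exact ⟨List.prefix_rfl, fun v h1 h2 h3 =>
          absurd (h3.eq_of_length_le h1.length_le) h2⟩
      | succ k ih =>
        have hj : p (m + (k + 1)) <+: p (m + k) ++ [f (m + k)] := by
          rw [← Nat.add_assoc, hps]; exact c.jump_prefix _
        refine ⟨List.prefix_of_prefix_length_le (ih.1.trans (List.prefix_append _ _)) hj
          (hmin _ (by omega)), fun v h1 h2 h3 => ?_⟩
        rcases List.prefix_concat_iff.1 (h3.trans hj) with rfl | h4
        · exact hR _ (by omega)
        · exact ih.2 v h1 h2 h4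
    -- A jump would land on an extension of `p m`, and its progress witness would be a right premise
    -- strictly above `p m`, which `key` and `hR` exclude.
    have hnj : ∀ k, p (m + (k + 1)) = p (m + k) ++ [f (m + k)] := by
      intro k
      rw [← Nat.add_assoc, hps, jump]
      split_ifs with h
      · exfalso
        obtain ⟨v, h1, h2, h3, h4⟩ := c.d_progress ⟨_, h⟩
        have hd : c.d ⟨_, h⟩ = p (m + (k + 1)) := by
          rw [← Nat.add_assoc, hps, jump, dif_pos h]
        rw [hd] at h1 h2
        have h5 := (key (k + 1)).1
        rcases List.prefix_concat_iff.1 h3 with rfl | h6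
        · exact hR _ (by omega) h4
        · refine (key k).2 v (h5.trans h1) (fun h7 => h2 ?_) h6 h4
          rw [h7] at h1 ⊢
          exact h5.eq_of_length_le h1.length_le
      · rfl
    have hlen : ∀ k, (p (m + k)).length = (p m).length + k := by
      intro k
      induction k with
      | zero => rfl
      | succ k ih => rw [hnj, List.length_append, ih]; simp [Nat.add_assoc]
    refine Set.infinite_of_injective_forall_mem (f := fun k => p (m + k)) ?_
      (fun k => hf (m + k)) c.finite
    intro k l hkl
    have := congrArg List.length hkl
    simp only [hlen] at this
    omega

end CyclicProof

/-! ### Contraction-tolerant inclusion of sequents -/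

/-- `Cov s b φ`: the occurrence of `φ` in the antecedent (if `b = true`) or the succedent
(if `b = false`) is accounted for by `s`, up to inversion of rules. -/
inductive Cov (s : Sequent α) : Bool → Formula α → Prop
  | memL {φ} : φ ∈ s.ante → Cov s true φ
  | memR {φ} : φ ∈ s.succ → Cov s false φ
  | impL_left {A B} : Cov s true B → Cov s true (Formula.imp A B)
  | impL_right {A B} : Cov s false A → Cov s true (Formula.imp A B)
  | impR {A B} : Cov s true A → Cov s false B → Cov s false (Formula.imp A B)
  | box {A} : Cov s false A → Cov s false (Formula.box A)

/-- Every formula occurrence of `t` is accounted for by `s`. -/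
structure Covers (s t : Sequent α) : Prop where
  ante : ∀ φ ∈ t.ante, Cov s true φ
  succ : ∀ φ ∈ t.succ, Cov s false φ

/-- Each premise of a rule, except the right one of (□), covers the conclusion. By transitivity it
still covers whatever the conclusion covered, which is what copying a rule requires. -/
lemma Cov.trans {s t : Sequent α} (h : Covers s t) {b : Bool} {φ : Formula α} (hφ : Cov t b φ) :
    Cov s b φ := by
  induction hφ with
  | memL hm => exact h.ante _ hm
  | memR hm => exact h.succ _ hm
  | impL_left _ ih => exact .impL_left ih
  | impL_right _ ih => exact .impL_right ih
  | impR _ _ ih1 ih2 => exact .impR ih1 ih2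
  | box _ ih => exact .box ih

lemma Covers.refl (s : Sequent α) : Covers s s := ⟨fun _ => .memL, fun _ => .memR⟩

lemma Covers.trans {s t u : Sequent α} (h : Covers s t) (h' : Covers t u) : Covers s u :=
  ⟨fun φ hφ => (h'.ante φ hφ).trans h, fun φ hφ => (h'.succ φ hφ).trans h⟩

lemma covers_cons_ante {s : Sequent α} {A : Formula α} {Γ Δ : Multiset (Formula α)} :
    Covers s ⟨A ::ₘ Γ, Δ⟩ ↔ Cov s true A ∧ Covers s ⟨Γ, Δ⟩ := by
  constructor
  · rintro ⟨h1, h2⟩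
    exact ⟨h1 _ (Multiset.mem_cons_self _ _), fun φ h => h1 _ (Multiset.mem_cons_of_mem h), h2⟩
  · rintro ⟨h, h1, h2⟩
    refine ⟨fun φ hφ => ?_, h2⟩
    rcases Multiset.mem_cons.1 hφ with rfl | hφ
    exacts [h, h1 _ hφ]

lemma covers_cons_succ {s : Sequent α} {A : Formula α} {Γ Δ : Multiset (Formula α)} :
    Covers s ⟨Γ, A ::ₘ Δ⟩ ↔ Cov s false A ∧ Covers s ⟨Γ, Δ⟩ := by
  constructor
  · rintro ⟨h1, h2⟩
    exact ⟨h2 _ (Multiset.mem_cons_self _ _), h1, fun φ h => h2 _ (Multiset.mem_cons_of_mem h)⟩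
  · rintro ⟨h, h1, h2⟩
    refine ⟨h1, fun φ hφ => ?_⟩
    rcases Multiset.mem_cons.1 hφ with rfl | hφ
    exacts [h, h2 _ hφ]

/-- No inversion clause of `Cov` yields an atom or ⊥, so these formulas occur literally in `s`. -/
lemma Covers.initial {s t : Sequent α} (h : Covers s t) (ht : Initial t) : Initial s := by
  obtain ⟨Γ, Δ⟩ := s
  cases ht with
  | ax p Γ' Δ' =>
    have h2 := (covers_cons_succ.1 h).1
    cases (covers_cons_ante.1 h).1 with
    | memL h1 =>
      cases h2 with
      | memR h2 =>
        obtain ⟨Γ, rfl⟩ := Multiset.exists_cons_of_mem h1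
        obtain ⟨Δ, rfl⟩ := Multiset.exists_cons_of_mem h2
        exact .ax p Γ Δ
  | bot Γ' Δ' =>
    cases (covers_cons_ante.1 h).1 with
    | memL h1 =>
      obtain ⟨Γ, rfl⟩ := Multiset.exists_cons_of_mem h1
      exact .bot Γ Δ

/-! ### Finiteness of the stock of right premises -/

/-- All formulas of the sequent belong to `S`. -/
def Sequent.Over (S : Set (Formula α)) (s : Sequent α) : Prop :=
  (∀ φ ∈ s.ante, φ ∈ S) ∧ ∀ φ ∈ s.succ, φ ∈ S

lemma Sequent.over_cons_ante {S : Set (Formula α)} {A : Formula α} {Γ Δ : Multiset (Formula α)} :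
    Sequent.Over S ⟨A ::ₘ Γ, Δ⟩ ↔ A ∈ S ∧ Sequent.Over S ⟨Γ, Δ⟩ := by
  simp [Sequent.Over, and_assoc]

lemma Sequent.over_cons_succ {S : Set (Formula α)} {A : Formula α} {Γ Δ : Multiset (Formula α)} :
    Sequent.Over S ⟨Γ, A ::ₘ Δ⟩ ↔ A ∈ S ∧ Sequent.Over S ⟨Γ, Δ⟩ := by
  simp [Sequent.Over, and_left_comm]

/-- Closure under immediate subformulas. -/
structure SubClosed (S : Set (Formula α)) : Prop where
  imp_left : ∀ {A B}, Formula.imp A B ∈ S → A ∈ S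
  imp_right : ∀ {A B}, Formula.imp A B ∈ S → B ∈ S
  box : ∀ {A}, Formula.box A ∈ S → A ∈ S

/-- The subformulas of a formula. -/
def Formula.subformulas : Formula α → Set (Formula α)
  | .bot => {.bot}
  | .atom p => {.atom p}
  | .imp A B => insert (.imp A B) (A.subformulas ∪ B.subformulas)
  | .box A => insert (.box A) A.subformulas

lemma Formula.self_mem_subformulas (φ : Formula α) : φ ∈ φ.subformulas := by
  cases φ <;> simp [Formula.subformulas]

lemma Formula.subformulas_finite (φ : Formula α) : φ.subformulas.Finite := by
  induction φ with
  | bot => exact Set.finite_singleton _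
  | atom p => exact Set.finite_singleton _
  | imp A B hA hB => exact (hA.union hB).insert _
  | box A hA => exact hA.insert _

lemma Formula.subformulas_subClosed (φ : Formula α) : SubClosed φ.subformulas := by
  induction φ with
  | bot => constructor <;> simp [Formula.subformulas]
  | atom p => constructor <;> simp [Formula.subformulas]
  | imp A B hA hB =>
    constructor
    · rintro C D (h | h | h)
      · cases h
        exact .inr (.inl A.self_mem_subformulas)
      · exact .inr (.inl (hA.imp_left h))
      · exact .inr (.inr (hB.imp_left h))
    · rintro C D (h | h | h)
      · cases h
        exact .inr (.inr B.self_mem_subformulas)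
      · exact .inr (.inl (hA.imp_right h))
      · exact .inr (.inr (hB.imp_right h))
    · rintro C (h | h | h)
      · cases h
      · exact .inr (.inl (hA.box h))
      · exact .inr (.inr (hB.box h))
  | box A hA =>
    constructor
    · rintro C D (h | h)
      · cases h
      · exact .inr (hA.imp_left h)
    · rintro C D (h | h)
      · cases h
      · exact .inr (hA.imp_right h)
    · rintro C (h | h)
      · cases h
        exact .inr A.self_mem_subformulas
      · exact .inr (hA.box h)

lemma exists_finite_subClosed (s : Sequent α) :
    ∃ S : Set (Formula α), S.Finite ∧ SubClosed S ∧ s.Over S := by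
  refine ⟨⋃ φ ∈ {φ | φ ∈ s.ante + s.succ}, φ.subformulas, ?_, ?_, ?_⟩
  · exact (Multiset.finite_toSet _).biUnion fun φ _ => φ.subformulas_finite
  · constructor
    · intro A B h
      obtain ⟨φ, hφ, h⟩ := Set.mem_iUnion₂.1 h
      exact Set.mem_iUnion₂.2 ⟨φ, hφ, φ.subformulas_subClosed.imp_left h⟩
    · intro A B h
      obtain ⟨φ, hφ, h⟩ := Set.mem_iUnion₂.1 h
      exact Set.mem_iUnion₂.2 ⟨φ, hφ, φ.subformulas_subClosed.imp_right h⟩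
    · intro A h
      obtain ⟨φ, hφ, h⟩ := Set.mem_iUnion₂.1 h
      exact Set.mem_iUnion₂.2 ⟨φ, hφ, φ.subformulas_subClosed.box h⟩
  · exact ⟨fun φ h => Set.mem_iUnion₂.2
        ⟨φ, Multiset.mem_add.2 (.inl h), φ.self_mem_subformulas⟩,
      fun φ h => Set.mem_iUnion₂.2
        ⟨φ, Multiset.mem_add.2 (.inr h), φ.self_mem_subformulas⟩⟩

/-- The sequents `□Π ⇒ A` with `Π` a set of formulas. -/
def rightPremise (x : Finset (Formula α) × Formula α) : Sequent α :=
  ⟨x.1.val.map Formula.box, {x.2}⟩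

/-- The sequents `□Π ⇒ A` with `Π` a set of formulas from `S` and `A` from `S`. -/
def rightPremises (S : Set (Formula α)) : Set (Sequent α) :=
  rightPremise '' ({P : Finset (Formula α) | (P : Set (Formula α)) ⊆ S} ×ˢ S)

lemma rightPremises_finite {S : Set (Formula α)} (hS : S.Finite) : (rightPremises S).Finite := by
  have hP : {P : Finset (Formula α) | (P : Set (Formula α)) ⊆ S}.Finite := by
    convert hS.toFinset.powerset.finite_toSet using 1
    ext P
    simp
  exact (hP.prod hS).image _

/-! ### Rebuilding an ∞-proof as a finite derivation -/

/-- `Cyc V s`: the sequent `s` has a finite derivation in which a right premise of the modal rule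
may be left open if it belongs to `V` or occurs below as a right premise. -/
inductive Cyc {α : Type*} : Set (Sequent α) → Sequent α → Prop
  | init {V s} : Initial s → Cyc V s
  | impL {V Γ Δ A B} : Cyc V ⟨B ::ₘ Γ, Δ⟩ → Cyc V ⟨Γ, A ::ₘ Δ⟩ →
      Cyc V ⟨Formula.imp A B ::ₘ Γ, Δ⟩
  | impR {V Γ Δ A B} : Cyc V ⟨A ::ₘ Γ, B ::ₘ Δ⟩ → Cyc V ⟨Γ, Formula.imp A B ::ₘ Δ⟩
  | refl {V Γ Δ B} : Cyc V ⟨B ::ₘ Formula.box B ::ₘ Γ, Δ⟩ → Cyc V ⟨Formula.box B ::ₘ Γ, Δ⟩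
  | boxOpen {V Γ Δ A} {Θ : Multiset (Formula α)} : Cyc V ⟨Γ + Θ.map Formula.box, A ::ₘ Δ⟩ →
      ⟨Θ.map Formula.box, {A}⟩ ∈ V → Cyc V ⟨Γ + Θ.map Formula.box, Formula.box A ::ₘ Δ⟩
  | box {V Γ Δ A} {Θ : Multiset (Formula α)} : Cyc V ⟨Γ + Θ.map Formula.box, A ::ₘ Δ⟩ →
      Cyc (insert ⟨Θ.map Formula.box, {A}⟩ V) ⟨Θ.map Formula.box, {A}⟩ →
      Cyc V ⟨Γ + Θ.map Formula.box, Formula.box A ::ₘ Δ⟩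

/-- Every sequent that covers a sequent of an `∞`-proof has a finite cyclic derivation. -/
lemma cyc_of_covers {S : Set (Formula α)} (hS : S.Finite) (hc : SubClosed S)
    {T : SeqTree α} (hT : T.IsInfProof) (n : ℕ) :
    ∀ V : Set (Sequent α), (rightPremises S \ V).ncard = n →
      ∀ v t, T.label v = some t → ∀ s : Sequent α, Covers s t → s.Over S → Cyc V s := by
  classical
  induction n using Nat.strong_induction_on with
  | _ n IH =>
  intro V hV v
  induction v using hT.wellFounded_localChild.induction with
  | _ v ih =>
  intro t ht s hst hs
  have hv : T.label v ≠ none := by simp [ht]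
  by_cases hb : T.IsStep Rule.box v
  · obtain ⟨t', l, ht', hinf, hl⟩ := hb
    obtain rfl : t = t' := Option.some.inj (ht.symm.trans ht')
    cases hinf with
    | box Γ Θ Δ A =>
    have h0 := hl 0
    have h1 := hl 1
    simp only [List.getElem?_cons_zero, List.getElem?_cons_succ] at h0 h1
    have hc0 : T.LocalChild (v ++ [0]) v := by
      refine ⟨⟨0, rfl⟩, by simp [h0], ?_⟩
      rintro ⟨w, hw, -⟩
      simpa using (List.append_inj' hw rfl).2
    have hsA := (covers_cons_succ.1 hst).1
    have hsrest := (covers_cons_succ.1 hst).2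
    -- Here `s` already covers the left premise, and (□) is skipped.
    by_cases hA : Cov s false A
    · exact ih _ hc0 _ h0 s (covers_cons_succ.2 ⟨hA, hsrest⟩) hs
    · cases hsA with
      | box h => exact absurd h hA
      | memR hm =>
      obtain ⟨Γs, Δs⟩ := s
      obtain ⟨Δ', rfl⟩ := Multiset.exists_cons_of_mem hm
      -- Without repetitions, membership gives inclusion of multisets. A boxed formula in the
      -- antecedent is covered only by membership, because `refl` keeps its principal formula.
      have hle : Θ.toFinset.val.map Formula.box ≤ Γs := by
        rw [Multiset.le_iff_subset]
        · intro φ hφ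
          obtain ⟨B, hB, rfl⟩ := Multiset.mem_map.1 hφ
          have hB' : B ∈ Θ := by simpa using hB
          have := hst.ante (Formula.box B)
            (Multiset.mem_add.2 (.inr (Multiset.mem_map_of_mem _ hB')))
          cases this with
          | memL h => exact h
        · exact Θ.toFinset.nodup.map fun _ _ h => Formula.box.inj h
      obtain ⟨Γ', rfl⟩ := Multiset.le_iff_exists_add.1 hle
      rw [add_comm] at hs hst ⊢
      have hAS : A ∈ S := hc.box (Sequent.over_cons_succ.1 hs).1
      have hΘS : ∀ B ∈ Θ, Formula.box B ∈ S := fun B hB =>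
        hs.1 _ (Multiset.mem_add.2 (.inr (Multiset.mem_map_of_mem _ (by simpa using hB))))
      have hleft : Cyc V ⟨Γ' + Θ.toFinset.val.map Formula.box, A ::ₘ Δ'⟩ := by
        refine ih _ hc0 _ h0 _ (covers_cons_succ.2 ⟨.memR (Multiset.mem_cons_self _ _),
          Covers.trans ?_ (covers_cons_succ.1 hst).2⟩)
          (Sequent.over_cons_succ.2 ⟨hAS, (Sequent.over_cons_succ.1 hs).2⟩)
        -- The copy of □A in `s` has been used up; further copies in `Δ` are accounted for by `A`.
        rw [covers_cons_succ]
        exact ⟨.box (.memR (Multiset.mem_cons_self _ _)), (covers_cons_succ.1 (.refl _)).2⟩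
      have hmem : (⟨Θ.toFinset.val.map Formula.box, {A}⟩ : Sequent α) ∈ rightPremises S :=
        ⟨(Θ.toFinset, A), ⟨fun B hB => hc.box (hΘS B (by simpa using hB)), hAS⟩, rfl⟩
      by_cases hrV : (⟨Θ.toFinset.val.map Formula.box, {A}⟩ : Sequent α) ∈ V
      · exact .boxOpen hleft hrV
      -- The right premise is not a local child, but adding its sequent to `V` lowers the outer
      -- count. Dropping repetitions from `Θ` is harmless, since covering only looks at membership.
      · refine .box hleft (IH _ ?_ _ rfl _ _ h1 _ ⟨fun φ hφ => .memL ?_, fun φ hφ => .memR hφ⟩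
          ⟨fun φ hφ => ?_, fun φ hφ => ?_⟩)
        · rw [← hV]
          refine Set.ncard_lt_ncard ?_ (rightPremises_finite hS).sdiff
          refine ⟨Set.sdiff_subset_sdiff_right (Set.subset_insert _ _), fun h => ?_⟩
          exact (h ⟨hmem, hrV⟩).2 (Set.mem_insert _ _)
        · obtain ⟨B, hB, rfl⟩ := Multiset.mem_map.1 hφ
          exact Multiset.mem_map_of_mem _ (by simpa using hB)
        · obtain ⟨B, hB, rfl⟩ := Multiset.mem_map.1 hφ
          exact hΘS B (by simpa using hB)
        · rwa [Multiset.mem_singleton.1 hφ]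
  · have hchild : ∀ i, T.label (v ++ [i]) ≠ none → T.LocalChild (v ++ [i]) v := by
      refine fun i hi => ⟨⟨i, rfl⟩, hi, ?_⟩
      rintro ⟨w, hw, hw'⟩
      exact hb ((List.append_inj' hw rfl).1 ▸ hw')
    rcases hT.local_correct v hv with ⟨-, t', ht', hi⟩ | ⟨r, hr⟩
    · obtain rfl : t = t' := Option.some.inj (ht.symm.trans ht')
      exact .init (hst.initial hi)
    · have hr' := hr
      obtain ⟨t', l, ht', hinf, hl⟩ := hr
      obtain rfl : t = t' := Option.some.inj (ht.symm.trans ht')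
      have h0 := hl 0
      have h1 := hl 1
      obtain ⟨Γs, Δs⟩ := s
      cases hinf with
      | box => exact absurd hr' hb
      | impL Γ Δ A B =>
        simp only [List.getElem?_cons_zero, List.getElem?_cons_succ] at h0 h1
        have hc0 := hchild 0 (by simp [h0])
        have hc1 := hchild 1 (by simp [h1])
        obtain ⟨hAB, hrest⟩ := covers_cons_ante.1 hst
        cases hAB with
        | impL_left h => exact ih _ hc0 _ h0 _ (covers_cons_ante.2 ⟨h, hrest⟩) hs
        | impL_right h => exact ih _ hc1 _ h1 _ (covers_cons_succ.2 ⟨h, hrest⟩) hs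
        | memL h =>
          obtain ⟨Γ', rfl⟩ := Multiset.exists_cons_of_mem h
          obtain ⟨hABS, hs'⟩ := Sequent.over_cons_ante.1 hs
          refine .impL
            (ih _ hc0 _ h0 _ (covers_cons_ante.2 ⟨.memL (Multiset.mem_cons_self _ _),
              Covers.trans ?_ hrest⟩) (Sequent.over_cons_ante.2 ⟨hc.imp_right hABS, hs'⟩))
            (ih _ hc1 _ h1 _ (covers_cons_succ.2 ⟨.memR (Multiset.mem_cons_self _ _),
              Covers.trans ?_ hrest⟩) (Sequent.over_cons_succ.2 ⟨hc.imp_left hABS, hs'⟩))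
          · exact covers_cons_ante.2 ⟨.impL_left (.memL (Multiset.mem_cons_self _ _)),
              (covers_cons_ante.1 (.refl _)).2⟩
          · exact covers_cons_ante.2 ⟨.impL_right (.memR (Multiset.mem_cons_self _ _)),
              (covers_cons_succ.1 (.refl _)).2⟩
      | impR Γ Δ A B =>
        simp only [List.getElem?_cons_zero] at h0
        have hc0 := hchild 0 (by simp [h0])
        obtain ⟨hAB, hrest⟩ := covers_cons_succ.1 hst
        cases hAB with
        | impR hA hB =>
          exact ih _ hc0 _ h0 _ (covers_cons_ante.2 ⟨hA, covers_cons_succ.2 ⟨hB, hrest⟩⟩) hs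
        | memR h =>
          obtain ⟨Δ', rfl⟩ := Multiset.exists_cons_of_mem h
          obtain ⟨hABS, hs'⟩ := Sequent.over_cons_succ.1 hs
          have hA : Cov (⟨A ::ₘ Γs, B ::ₘ Δ'⟩ : Sequent α) true A :=
            .memL (Multiset.mem_cons_self _ _)
          have hB : Cov (⟨A ::ₘ Γs, B ::ₘ Δ'⟩ : Sequent α) false B :=
            .memR (Multiset.mem_cons_self _ _)
          refine .impR (ih _ hc0 _ h0 _ (covers_cons_ante.2 ⟨hA, covers_cons_succ.2 ⟨hB,
            Covers.trans ?_ hrest⟩⟩) (Sequent.over_cons_ante.2 ⟨hc.imp_left hABS,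
              Sequent.over_cons_succ.2 ⟨hc.imp_right hABS, hs'⟩⟩))
          exact covers_cons_succ.2 ⟨.impR hA hB,
            (covers_cons_succ.1 (covers_cons_ante.1 (.refl _)).2).2⟩
      | refl Γ Δ B =>
        simp only [List.getElem?_cons_zero] at h0
        have hc0 := hchild 0 (by simp [h0])
        obtain ⟨hB, hrest⟩ := covers_cons_ante.1 hst
        cases hB with
        | memL h =>
          obtain ⟨Γ', rfl⟩ := Multiset.exists_cons_of_mem h
          refine .refl (ih _ hc0 _ h0 _ (covers_cons_ante.2 ⟨.memL (Multiset.mem_cons_self _ _),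
            Covers.trans (covers_cons_ante.1 (.refl _)).2 hst⟩)
            (Sequent.over_cons_ante.2 ⟨hc.box (Sequent.over_cons_ante.1 hs).1, hs⟩))

/-! ### From derivations to trees -/

/-- `T` is a finite tree for `s` such that each of its open leaves is a right premise marked by a
sequent that belongs to `V` or marks a node properly below. -/
structure IsCyclicTree (V : Set (Sequent α)) (s : Sequent α) (T : SeqTree α) : Prop where
  root : T.label [] = some s
  finite : {v : List ℕ | T.label v ≠ none}.Finite
  local_correct : ∀ v : List ℕ, T.label v ≠ none → T.IsLeaf v ∨ ∃ r, T.IsStep r v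
  isRightPremise : ∀ a, T.IsOpenLeaf a → T.IsRightPremise a
  link : ∀ a, T.IsOpenLeaf a → (∃ t ∈ V, T.label a = some t) ∨
    ∃ b, b <+: a ∧ b ≠ a ∧ T.label b = T.label a

/-- The tree `T` may be used as the `i`-th premise of an application of the rule `r` to obtain
a cyclic tree relative to `V`. -/
structure IsPremiseTree (V : Set (Sequent α)) (r : Rule) (i : ℕ) (T : SeqTree α) : Prop where
  finite : {v : List ℕ | T.label v ≠ none}.Finite
  local_correct : ∀ v : List ℕ, T.label v ≠ none → T.IsLeaf v ∨ ∃ r, T.IsStep r v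
  isRightPremise : ∀ a, T.IsOpenLeaf a → T.IsRightPremise a ∨ a = [] ∧ r = Rule.box ∧ i = 1
  link : ∀ a, T.IsOpenLeaf a → (∃ t ∈ V, T.label a = some t) ∨
    ∃ b, b <+: a ∧ b ≠ a ∧ T.label b = T.label a

lemma IsCyclicTree.isPremiseTree {V : Set (Sequent α)} {s : Sequent α} {T : SeqTree α}
    (h : IsCyclicTree V s T) (r : Rule) (i : ℕ) : IsPremiseTree V r i T :=
  ⟨h.finite, h.local_correct, fun a ha => .inl (h.isRightPremise a ha), h.link⟩

/-- Leaves marked by the discharged sequent `s` are linked to the root. They are right premises,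
hence differ from the root. -/
lemma IsCyclicTree.isPremiseTree_of_insert {V : Set (Sequent α)} {s : Sequent α} {T : SeqTree α}
    (h : IsCyclicTree (insert s V) s T) (r : Rule) (i : ℕ) : IsPremiseTree V r i T := by
  refine ⟨h.finite, h.local_correct, fun a ha => .inl (h.isRightPremise a ha), fun a ha => ?_⟩
  rcases h.link a ha with ⟨t, rfl | ht, hat⟩ | hb
  · refine .inr ⟨[], List.nil_prefix, ?_, h.root.trans hat.symm⟩
    obtain ⟨w, rfl, -⟩ := h.isRightPremise a ha
    simp
  · exact .inl ⟨t, ht, hat⟩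
  · exact .inr hb

/-- The single node becomes a right premise only after grafting, which is why `IsPremiseTree`
exempts the root in this position. -/
lemma isPremiseTree_leaf {V : Set (Sequent α)} {s : Sequent α} (hs : s ∈ V) :
    IsPremiseTree V Rule.box 1 (SeqTree.node s []) := by
  have h0 : ∀ i v, (SeqTree.node s []).label (i :: v) = none := fun i v =>
    SeqTree.node_label_cons_none (by simp) v
  refine ⟨SeqTree.node_finite _ _ (by simp), ?_, ?_, ?_⟩
  · rintro (_ | ⟨i, v⟩) hv
    · exact .inl ⟨hv, fun i => h0 i []⟩
    · exact absurd (h0 i v) hv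
  · rintro (_ | ⟨i, v⟩) hv
    · exact .inr ⟨rfl, rfl, rfl⟩
    · exact absurd (h0 i v) hv.1.1
  · rintro (_ | ⟨i, v⟩) hv
    · exact .inl ⟨s, hs, rfl⟩
    · exact absurd (h0 i v) hv.1.1

lemma isCyclicTree_node {V : Set (Sequent α)} {s : Sequent α} {r : Rule} {l : List (Sequent α)}
    {ts : List (SeqTree α)} (hr : Inference r l s)
    (hl : ts.map (fun T => T.label []) = l.map some)
    (hts : ∀ i T, ts[i]? = some T → IsPremiseTree V r i T) :
    IsCyclicTree V s (SeqTree.node s ts) := by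
  have hstep := SeqTree.node_isStep_nil hr hl
  -- Every rule has at least one premise.
  have hroot : ¬ (SeqTree.node s ts).IsOpenLeaf [] := by
    intro h
    have h0 := h.1.2 0
    obtain ⟨s', l', -, hinf, hl'⟩ := hstep
    rw [hl'] at h0
    cases hinf <;> simp at h0
  refine ⟨rfl, SeqTree.node_finite _ _ fun T hT => ?_, ?_, ?_, ?_⟩
  · obtain ⟨i, hi⟩ := List.mem_iff_getElem?.1 hT
    exact (hts i T hi).finite
  · rintro (_ | ⟨i, v⟩) hv
    · exact .inr ⟨r, hstep⟩
    · rcases hi : ts[i]? with _ | T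
      · exact absurd (SeqTree.node_label_cons_none hi v) hv
      · rw [SeqTree.node_label_cons hi] at hv
        simpa only [SeqTree.node_isLeaf_cons hi, SeqTree.node_isStep_cons hi] using
          (hts i T hi).local_correct v hv
  · rintro (_ | ⟨i, v⟩) hv
    · exact absurd hv hroot
    · rcases hi : ts[i]? with _ | T
      · exact absurd (SeqTree.node_label_cons_none hi v) hv.1.1
      · rw [SeqTree.node_isOpenLeaf_cons hi] at hv
        rcases (hts i T hi).isRightPremise v hv with h | ⟨rfl, rfl, rfl⟩
        · exact SeqTree.node_isRightPremise_cons hi h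
        · exact ⟨[], rfl, hstep⟩
  · rintro (_ | ⟨i, v⟩) hv
    · exact absurd hv hroot
    · rcases hi : ts[i]? with _ | T
      · exact absurd (SeqTree.node_label_cons_none hi v) hv.1.1
      · rw [SeqTree.node_isOpenLeaf_cons hi] at hv
        rcases (hts i T hi).link v hv with ⟨t, ht, hvt⟩ | ⟨b, hb, hne, hbl⟩
        · exact .inl ⟨t, ht, (SeqTree.node_label_cons hi v).trans hvt⟩
        · refine .inr ⟨i :: b, List.cons_prefix_cons.2 ⟨rfl, hb⟩, by simpa using hne, ?_⟩
          rw [SeqTree.node_label_cons hi, SeqTree.node_label_cons hi, hbl]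

lemma isCyclicTree_node_one {V : Set (Sequent α)} {s s₀ : Sequent α} {r : Rule}
    {T : SeqTree α} (hr : Inference r [s₀] s) (hT : IsCyclicTree V s₀ T) :
    IsCyclicTree V s (SeqTree.node s [T]) := by
  refine isCyclicTree_node hr (by simp [hT.root]) ?_
  rintro (_ | i) T' h <;> simp at h
  exact h ▸ hT.isPremiseTree _ _

lemma isCyclicTree_node_two {V : Set (Sequent α)} {s s₀ s₁ : Sequent α} {r : Rule}
    {T₀ T₁ : SeqTree α} (hr : Inference r [s₀, s₁] s) (h₀ : IsCyclicTree V s₀ T₀)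
    (hroot : T₁.label [] = some s₁) (h₁ : IsPremiseTree V r 1 T₁) :
    IsCyclicTree V s (SeqTree.node s [T₀, T₁]) := by
  refine isCyclicTree_node hr (by simp [h₀.root, hroot]) ?_
  rintro (_ | _ | i) T' h <;> simp at h
  · exact h ▸ h₀.isPremiseTree _ _
  · exact h ▸ h₁

lemma isCyclicTree_init {V : Set (Sequent α)} {s : Sequent α} (hs : Initial s) :
    IsCyclicTree V s (SeqTree.node s []) := by
  have h0 : ∀ i v, (SeqTree.node s []).label (i :: v) = none := fun i v =>
    SeqTree.node_label_cons_none (by simp) v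
  have hno : ∀ a, ¬ (SeqTree.node s []).IsOpenLeaf a := by
    rintro (_ | ⟨i, v⟩) hv
    · exact hv.2 ⟨s, rfl, hs⟩
    · exact hv.1.1 (h0 i v)
  refine ⟨rfl, SeqTree.node_finite _ _ (by simp), ?_, fun a ha => absurd ha (hno a),
    fun a ha => absurd ha (hno a)⟩
  rintro (_ | ⟨i, v⟩) hv
  · exact .inl ⟨hv, fun i => h0 i []⟩
  · exact absurd (h0 i v) hv

lemma Cyc.exists_isCyclicTree {V : Set (Sequent α)} {s : Sequent α} (h : Cyc V s) :
    ∃ T, IsCyclicTree V s T := by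
  induction h with
  | init h => exact ⟨_, isCyclicTree_init h⟩
  | impL _ _ ih₀ ih₁ =>
    obtain ⟨T₀, h₀⟩ := ih₀
    obtain ⟨T₁, h₁⟩ := ih₁
    exact ⟨_, isCyclicTree_node_two (.impL _ _ _ _) h₀ h₁.root (h₁.isPremiseTree _ _)⟩
  | impR _ ih =>
    obtain ⟨T, h⟩ := ih
    exact ⟨_, isCyclicTree_node_one (.impR _ _ _ _) h⟩
  | refl _ ih =>
    obtain ⟨T, h⟩ := ih
    exact ⟨_, isCyclicTree_node_one (.refl _ _ _) h⟩
  | boxOpen _ hV ih =>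
    obtain ⟨T, h⟩ := ih
    exact ⟨_, isCyclicTree_node_two (.box _ _ _ _) h rfl (isPremiseTree_leaf hV)⟩
  | box _ _ ih₀ ih₁ =>
    obtain ⟨T₀, h₀⟩ := ih₀
    obtain ⟨T₁, h₁⟩ := ih₁
    exact ⟨_, isCyclicTree_node_two (.box _ _ _ _) h₀ h₁.root (h₁.isPremiseTree_of_insert _ _)⟩

/-- With no sequents allowed from outside, every open leaf repeats a sequent below it, and the leaf
itself witnesses progress. -/
lemma IsCyclicTree.exists_cyclicProof {s : Sequent α} {T : SeqTree α} (h : IsCyclicTree ∅ s T) :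
    ∃ c : CyclicProof α, c.κ = T := by
  have hd : ∀ a : {a : List ℕ // T.IsOpenLeaf a},
      ∃ b, b <+: a.1 ∧ b ≠ a.1 ∧ T.label b = T.label a.1 := by
    intro a
    rcases h.link a.1 a.2 with ⟨t, ht, -⟩ | hb
    · exact absurd ht (Set.notMem_empty t)
    · exact hb
  choose d h1 h2 h3 using hd
  exact ⟨⟨T, h.finite, h.local_correct, d, h1, h3, fun a =>
    ⟨a.1, h1 a, (h2 a).symm, List.prefix_rfl, h.isRightPremise a.1 a.2⟩⟩, rfl⟩

end GrzInf

theorem mainTheorem4 {α : Type*} (Γ Δ : Multiset (GrzInf.Formula α))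
    (h : GrzInf.Provable (⟨Γ, Δ⟩ : GrzInf.Sequent α)) :
    ∃ c : GrzInf.CyclicProof α, c.κ.label [] = some ⟨Γ, Δ⟩ ∧ c.unravel.IsInfProof := by
  obtain ⟨T, hT, hroot⟩ := h
  obtain ⟨S, hS, hc, hs⟩ := GrzInf.exists_finite_subClosed ⟨Γ, Δ⟩
  obtain ⟨K, hK⟩ := (GrzInf.cyc_of_covers hS hc hT _ ∅ rfl [] _ hroot _ (.refl _)
    hs).exists_isCyclicTree
  obtain ⟨c, rfl⟩ := hK.exists_cyclicProof
  exact ⟨c, hK.root, c.unravel_isInfProof⟩
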